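/- Let $\mathbb S=\mathbb R/\mathbb Z$ be identified with $[0,1]$ with its endpoints glued, let $\lambda$ be Lebesgue measure, $H^0=L^2(\mathbb S)$, and let $H^1$ be the space of absolutely continuous functions on $\mathbb S$ with derivative in $L^2(\mathbb S)$. Let $M^{AC}$ be the set of nondecreasing absolutely continuous $\varphi:[0,1]\to[0,1]$ with $\varphi(0)=0$, $\varphi(1)=1$, and let $\mathcal M^0_{AC}=M^{AC}\times H^0$ (the underlying set of the semidirect product). Put $T_{id}=\{u\in H^1: u(0)=0\}\times H^0$ with inner product $\langle(u,\rho),(v,\sigma)\rangle_{id}=\frac14\int_{\mathbb S}(u_xv_x+\rho\sigma)\,dx$. For $\varphi\in M^{AC}$ let $T_\varphi=\{(u\circ\varphi,\rho\circ\varphi):(u,\rho)\in T_{id}\}$ (second components up to equality a.e.), and carry over the inner product by right translation: $\langle(u\circ\varphi,\rho\circ\varphi),(v\circ\varphi,\sigma\circ\varphi)\rangle_{\varphi}=\langle(u,\rho),(v,\sigma)\rangle_{id}$. Let $$\Gamma_{id}((u,\rho),(v,\sigma))=\Big(-\tfrac12A^{-1}\partial_x(u_xv_x+\rho\sigma),\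 -\tfrac12(u_x\sigma+v_x\rho)\Big),\qquad (A^{-1}\partial_xh)(x)=-\int_0^xh\,dy+x\int_0^1h\,dy,$$ where $A=-\partial_x^2$, and extend $\Gamma$ by right translation, $\Gamma_\varphi((u\circ\varphi,\rho\circ\varphi),(v\circ\varphi,\sigma\circ\varphi))=\Gamma_{id}((u,\rho),(v,\sigma))\circ\varphi$. Let $(\tilde u,\tilde\rho)\in T_{id}$ with $\|\tilde u_x\|_{L^2}^2+\|\tilde\rho\|_{L^2}^2=4$. Define $$\varphi(t,x)=\int_0^x(f^2+g^2)(t,y)\,dy,\quad f=\cos t+\tfrac{\tilde u_x}{2}\sin t,\quad g=\tfrac{\tilde\rho}{2}\sin t,\qquad \varrho(t,x)=\tilde\rho(x)\int_0^t\frac{\chi_{\{\varphi_x(s,\cdot)>0\}}(x)}{\varphi_x(s,x)}\,ds ,$$ where $\varrho(t,x)=0$ if $\tilde\rho(x)=0$. For every $x\in[0,1]$ the derivatives $\varphi_t,\varphi_{tt}$, and for a.e. $x$ the derivatives $\varrho_t,\varrho_{tt}$, exist at all $t\ge0$, and the following hold. (i) For every $t\ge 0$, $(\varphi(t,\cdot),\varrho(t,\cdot))\in\mathcal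 M^0_{AC}$. (ii) For every $t\ge0$, $(\varphi_t(t,\cdot),\varrho_t(t,\cdot))\in T_{\varphi(t,\cdot)}$. Moreover, with $N=\{x:\varphi_x(t,x)\text{ exists and equals }0\}$, $\varphi_t(t,\cdot)$ is absolutely continuous on $\mathbb S$, $\varphi_t(t,0)=0$, $\varphi_{tx}(t,\cdot)=0$ a.e. on $N$, $\varrho_t(t,\cdot)$ is measurable, and $\int_{\mathbb S\setminus N}\big(\frac{\varphi_{tx}^2}{\varphi_x}+\varrho_t^2\varphi_x\big)dx<\infty$. (iii) For every $t\ge0$, $$\big\langle(\varphi_t,\varrho_t),(\varphi_t,\varrho_t)\big\rangle_{\varphi}=\frac14\int_{\mathbb S\setminus N}\Big(\frac{\varphi_{tx}^2}{\varphi_x}+\varrho_t^2\varphi_x\Big)dx=\begin{cases}1,&\sin t=0,\\ 1-\frac1{\sin^2t}\,\lambda\big(\{\tilde u_x=-2\cot t\}\cap\{\tilde\rho=0\}\big),&\sin t\ne0.\end{cases}$$ In particular, for a.e. $t\ge0$ this energy equals its value at $t=0$. (iv) For a.e. $t\ge0$ the geodesic equation $(\varphi_{tt},\varrho_{tt})=\Gamma_{\varphi}\big((\varphi_t,\varrho_t),(\varphi_t,\varrho_t)\big)$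 holds, the first component for every $x\in[0,1]$ and the second for a.e. $x$. -/

import Mathlib

open MeasureTheory Set

noncomputable section

namespace HS

/-! The circle is `[0,1]` with its endpoints identified. A function on it is a function `ℝ → ℝ` of
which only the values on `[0,1]` matter, subject to `v 0 = v 1` where it is to be continuous. -/

/-- Lebesgue measure on the circle. -/
def lam : Measure ℝ := volume.restrict (Icc (0 : ℝ) 1)

/-- `H⁰`: the square-integrable functions on the circle. -/
def H0 : Set (ℝ → ℝ) := {r | MemLp r 2 lam}

/-- The absolutely continuous functions on the circle. -/
def AC : Set (ℝ → ℝ) := {v | AbsolutelyContinuousOnInterval v 0 1 ∧ v 0 = v 1}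

/-- `H¹`: the absolutely continuous functions on the circle whose a.e. derivative is
square-integrable. -/
def H1 : Set (ℝ → ℝ) := {v | v ∈ AC ∧ deriv v ∈ H0}

/-- `M^AC`: the nondecreasing absolutely continuous `φ : [0,1] → [0,1]` with `φ 0 = 0`, `φ 1 = 1`. -/
def MAC : Set (ℝ → ℝ) :=
  {φ | MapsTo φ (Icc 0 1) (Icc 0 1) ∧ MonotoneOn φ (Icc 0 1) ∧
    AbsolutelyContinuousOnInterval φ 0 1 ∧ φ 0 = 0 ∧ φ 1 = 1}

/-- The underlying set `M^AC × H⁰` of the semidirect product. -/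
def MAC0 : Set ((ℝ → ℝ) × (ℝ → ℝ)) := MAC ×ˢ H0

/-- The tangent space at the identity: `{u ∈ H¹ : u 0 = 0} × H⁰`. -/
def tangentId : Set ((ℝ → ℝ) × (ℝ → ℝ)) := {u | u ∈ H1 ∧ u 0 = 0} ×ˢ H0

/-- `X = (U,F)` is the image `(u ∘ φ, ρ ∘ φ)` of the vector `w = (u,ρ)` at the identity under the
tangent map of right translation `(ψ,h) ↦ (ψ ∘ φ, ϱ + h ∘ φ)` by `(φ,ϱ)`. The tangent map does not
depend on `ϱ`. -/
def IsTranslate (φ : ℝ → ℝ) (X w : (ℝ → ℝ) × (ℝ → ℝ)) : Prop :=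
  w ∈ tangentId ∧ (∀ x ∈ Icc (0 : ℝ) 1, X.1 x = w.1 (φ x)) ∧ X.2 =ᵐ[lam] w.2 ∘ φ

/-- The tangent space: all right translates by `φ` of tangent vectors at the identity. -/
def tangent (φ : ℝ → ℝ) : Set ((ℝ → ℝ) × (ℝ → ℝ)) := {X | ∃ w, IsTranslate φ X w}

open Classical in
/-- The vector `(u,ρ) = (U ∘ φ⁻¹, F ∘ φ⁻¹)` at the identity of which a tangent vector `(U,F)` is the
right translate. For `φ` in `M^AC` it is unique (`ρ` as an element of `H⁰`). -/
def pullId (φ : ℝ → ℝ) (X : (ℝ → ℝ) × (ℝ → ℝ)) : (ℝ → ℝ) × (ℝ → ℝ) :=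
  if h : ∃ w, IsTranslate φ X w then h.choose else 0

/-- The inner product `¼ ∫ (u_x v_x + ρ σ)` at the identity. -/
def innerId (X Y : (ℝ → ℝ) × (ℝ → ℝ)) : ℝ :=
  1 / 4 * ∫ x, (deriv X.1 x * deriv Y.1 x + X.2 x * Y.2 x) ∂lam

/-- The right-invariant inner product on the tangent space at `φ`. -/
def innerAt (φ : ℝ → ℝ) (X Y : (ℝ → ℝ) × (ℝ → ℝ)) : ℝ := innerId (pullId φ X) (pullId φ Y)

/-- The set on which `φ_x` exists and equals `0`. -/
def nullSet (φ : ℝ → ℝ) : Set ℝ := {x ∈ Icc (0 : ℝ) 1 | HasDerivAt φ 0 x}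

/-- The conditions that describe tangent vectors `(U,F)` at `φ` without reference to the identity:
`U` is absolutely continuous with `U 0 = 0`, `U_x = 0` a.e. on `N = {φ_x = 0}`, `F` is measurable,
and `U_x² / φ_x + F² φ_x` is integrable off `N`. -/
def TangentConditions (φ : ℝ → ℝ) (X : (ℝ → ℝ) × (ℝ → ℝ)) : Prop :=
  X.1 ∈ AC ∧ X.1 0 = 0 ∧ AEStronglyMeasurable X.2 lam ∧
  (∀ᵐ x ∂volume.restrict (nullSet φ), deriv X.1 x = 0) ∧
  IntegrableOn (fun x => deriv X.1 x ^ 2 / deriv φ x + X.2 x ^ 2 * deriv φ x)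
    (Icc 0 1 \ nullSet φ)

/-- The inverse of `A = -∂ₓ²`, for functions of mean zero. -/
def Ainv (h : ℝ → ℝ) (x : ℝ) : ℝ :=
  -(∫ y in (0 : ℝ)..x, ∫ z in (0 : ℝ)..y, h z) + x * ∫ y in (0 : ℝ)..1, ∫ z in (0 : ℝ)..y, h z

/-- The operator `A⁻¹ ∂ₓ`, extended from `C¹` to integrable functions. -/
def AinvDx (h : ℝ → ℝ) (x : ℝ) : ℝ := -(∫ y in (0 : ℝ)..x, h y) + x * ∫ y in (0 : ℝ)..1, h y

theorem Ainv_deriv {h : ℝ → ℝ} (hh : ContDiff ℝ 1 h) (x : ℝ) : Ainv (deriv h) x = AinvDx h x := by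
  have hc : Continuous (deriv h) := hh.continuous_deriv le_rfl
  have key : ∀ y : ℝ, ∫ z in (0 : ℝ)..y, deriv h z = h y - h 0 := fun y =>
    intervalIntegral.integral_deriv_eq_sub
      (fun z _ => (hh.differentiable one_ne_zero).differentiableAt) (hc.intervalIntegrable _ _)
  have key2 : ∀ y : ℝ, ∫ z in (0 : ℝ)..y, (h z - h 0) = (∫ z in (0 : ℝ)..y, h z) - y * h 0 := by
    intro y
    rw [intervalIntegral.integral_sub (hh.continuous.intervalIntegrable _ _) (by simp)]
    simp
  simp only [Ainv, AinvDx, key, key2]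
  ring

/-- The Christoffel operator at the identity, with components
`-½ A⁻¹∂ₓ(u_x v_x) - ½ A⁻¹∂ₓ(ρ σ)` and `-½ (u_x σ + v_x ρ)`. -/
def GammaId (X Y : (ℝ → ℝ) × (ℝ → ℝ)) : (ℝ → ℝ) × (ℝ → ℝ) :=
  (fun x => -(1 / 2) * AinvDx (fun y => deriv X.1 y * deriv Y.1 y) x
      - 1 / 2 * AinvDx (fun y => X.2 y * Y.2 y) x,
   fun x => -(1 / 2) * (deriv X.1 x * Y.2 x + deriv Y.1 x * X.2 x))

/-- The Christoffel operator at `φ`, extended from the identity by right translation. -/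
def GammaAt (φ : ℝ → ℝ) (X Y : (ℝ → ℝ) × (ℝ → ℝ)) : (ℝ → ℝ) × (ℝ → ℝ) :=
  ((GammaId (pullId φ X) (pullId φ Y)).1 ∘ φ, (GammaId (pullId φ X) (pullId φ Y)).2 ∘ φ)

/-- The time derivative of a function of `(t,x)`. -/
def dt (F : ℝ → ℝ → ℝ) (t x : ℝ) : ℝ := deriv (fun s => F s x) t

/-- `f = cos t + (ũ_x / 2) sin t`. -/
def f (u : ℝ → ℝ) (t x : ℝ) : ℝ := Real.cos t + deriv u x / 2 * Real.sin t

/-- `g = (ρ̃ / 2) sin t`. -/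
def g (r : ℝ → ℝ) (t x : ℝ) : ℝ := r x / 2 * Real.sin t

/-- `φ(t,x) = ∫₀ˣ (f² + g²)`. -/
def phi (u r : ℝ → ℝ) (t x : ℝ) : ℝ := ∫ y in (0 : ℝ)..x, (f u t y ^ 2 + g r t y ^ 2)

/-- `ϱ(t,x) = ρ̃(x) ∫₀ᵗ χ_{φ_x(s,·) > 0}(x) / φ_x(s,x) ds`. -/
def varrho (u r : ℝ → ℝ) (t x : ℝ) : ℝ :=
  r x * ∫ s in (0 : ℝ)..t, {y | 0 < deriv (phi u r s) y}.indicator (fun y => 1 / deriv (phi u r s) y) x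

/-- The velocity `(φ_t, ϱ_t)` at time `t`. -/
def vel (u r : ℝ → ℝ) (t : ℝ) : (ℝ → ℝ) × (ℝ → ℝ) := (dt (phi u r) t, dt (varrho u r) t)

/-- The energy `⟨(φ_t, ϱ_t), (φ_t, ϱ_t)⟩` at time `t`. -/
def energy (u r : ℝ → ℝ) (t : ℝ) : ℝ := innerAt (phi u r t) (vel u r t) (vel u r t)

/-- `1` if `sin t = 0`, and `1 - λ({ũ_x = -2 cot t} ∩ {ρ̃ = 0}) / sin² t` otherwise. -/
def energyValue (u r : ℝ → ℝ) (t : ℝ) : ℝ :=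
  if Real.sin t = 0 then 1
  else 1 - 1 / Real.sin t ^ 2 * lam.real ({x | deriv u x = -2 * Real.cot t} ∩ {x | r x = 0})

end HS

end

noncomputable section

namespace HS

/-! Put `z = f + i g = cos t + w sin t` with `w = (ũ_x + i ρ̃)/2`. The norm condition says that `w`
has norm 1 in `L²(𝕊; ℂ)`, and `w` is real-orthogonal to 1 because `ũ` is periodic, so `t ↦ z` is a
unit-speed great circle and `φ_x = |z|²` is a probability density. Moreover `φ_tx = 2 Re(z̄ z_t)`,
and `2 Im(z̄ z_t) = ρ̃` is conserved, which gives `φ_tx² + ρ̃² = 4 |z_t|² |z|²` (`densDt_sq_add`).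
As `ϱ_t = ρ̃/φ_x`, the energy density is `4 |z_t|²` where `z ≠ 0` and 0 where `z = 0`. Since `∫
|z_t|² = 1`, the energy falls short of 1 by the integral of `|z_t|²` over the zero set of `z`, where
it equals `1/sin² t`. For each `x` the zeros in `t` are countable, so by Fubini this loss vanishes
for almost every `t`.

Eulerian quantities are reached through the fact that `φ` pushes `φ_x dx` forward to Lebesgue
measure (`IsDensity.map_prim`). The pulled-back vector satisfies `u_x ∘ φ = φ_tx/φ_x` and `ρ ∘ φ =
ϱ_t` where `φ_x ≠ 0`, and its integrals become integrals in `x`. In this form the geodesic equation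
is `z_tt = -z` together with the derivative of `ρ̃/φ_x`. -/

/-! ### Lebesgue measure on the circle and primitives. -/

theorem integrable_lam_iff {h : ℝ → ℝ} : Integrable h lam ↔ IntervalIntegrable h volume 0 1 := by
  rw [intervalIntegrable_iff_integrableOn_Icc_of_le zero_le_one]
  rfl

theorem intervalIntegrable_of_lam {h : ℝ → ℝ} (hh : Integrable h lam) {x : ℝ}
    (hx : x ∈ Icc (0 : ℝ) 1) : IntervalIntegrable h volume 0 x :=
  (integrable_lam_iff.1 hh).mono_set (by
    rw [uIcc_of_le hx.1, uIcc_of_le zero_le_one]; exact Icc_subset_Icc_right hx.2)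

theorem lam_restrict_Iic {x : ℝ} (hx : x ≤ 1) :
    lam.restrict (Iic x) = volume.restrict (Icc (0 : ℝ) x) := by
  rw [lam, Measure.restrict_restrict measurableSet_Iic]
  congr 1
  ext y
  simp only [mem_inter_iff, mem_Iic, mem_Icc]
  constructor
  · rintro ⟨h1, h2, -⟩
    exact ⟨h2, h1⟩
  · rintro ⟨h1, h2⟩
    exact ⟨h2, h1, h2.trans hx⟩

theorem setIntegral_lam_Iic (h : ℝ → ℝ) {x : ℝ} (hx : x ∈ Icc (0 : ℝ) 1) :
    ∫ y in Iic x, h y ∂lam = ∫ y in (0 : ℝ)..x, h y := by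
  rw [lam_restrict_Iic hx.2, integral_Icc_eq_integral_Ioc, intervalIntegral.integral_of_le hx.1]

theorem integral_lam (h : ℝ → ℝ) : ∫ y, h y ∂lam = ∫ y in (0 : ℝ)..1, h y := by
  rw [lam, integral_Icc_eq_integral_Ioc, intervalIntegral.integral_of_le zero_le_one]

theorem ae_lam_mem_Icc : ∀ᵐ x ∂lam, x ∈ Icc (0 : ℝ) 1 := ae_restrict_mem measurableSet_Icc

theorem ae_lam_mem_Ioo : ∀ᵐ x ∂lam, x ∈ Ioo (0 : ℝ) 1 := by
  rw [lam, ← Measure.restrict_congr_set Ioo_ae_eq_Icc]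
  exact ae_restrict_mem measurableSet_Ioo

instance : IsProbabilityMeasure lam := ⟨by simp [lam]⟩

theorem lam_absolutelyContinuous : lam ≪ volume := Measure.absolutelyContinuous_of_le
  Measure.restrict_le_self

/-- The primitive vanishing at `0`. -/
def prim (q : ℝ → ℝ) (x : ℝ) : ℝ := ∫ y in (0 : ℝ)..x, q y

@[simp] theorem prim_zero (q : ℝ → ℝ) : prim q 0 = 0 := by simp [prim]

theorem ac_prim {q : ℝ → ℝ} (hq : Integrable q lam) :
    AbsolutelyContinuousOnInterval (prim q) 0 1 :=
  (integrable_lam_iff.1 hq).absolutelyContinuousOnInterval_intervalIntegral (by simp)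

theorem continuousOn_prim {q : ℝ → ℝ} (hq : Integrable q lam) : ContinuousOn (prim q) (Icc 0 1) := by
  simpa [uIcc_of_le] using (ac_prim hq).continuousOn

theorem ae_hasDerivAt_prim {q : ℝ → ℝ} (hq : Integrable q lam) :
    ∀ᵐ x ∂lam, HasDerivAt (prim q) (q x) x := by
  filter_upwards [lam_absolutelyContinuous.ae_le
    (integrable_lam_iff.1 hq).ae_hasDerivAt_integral, ae_lam_mem_Icc] with x hx hx'
  exact hx (by rwa [uIcc_of_le zero_le_one]) 0 (by simp)

theorem prim_congr {p q : ℝ → ℝ} (h : p =ᵐ[lam] q) {x : ℝ} (hx : x ∈ Icc (0 : ℝ) 1) :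
    prim p x = prim q x := by
  rw [prim, prim, ← setIntegral_lam_Iic _ hx, ← setIntegral_lam_Iic _ hx]
  exact integral_congr_ae (ae_restrict_of_ae h)

/-- Functions that agree on `[0,1]` have the same derivatives at almost every point of it. -/
theorem eventuallyEq_of_eqOn {v w : ℝ → ℝ} (h : EqOn v w (Icc 0 1)) {x : ℝ}
    (hx : x ∈ Ioo (0 : ℝ) 1) : v =ᶠ[nhds x] w := by
  filter_upwards [Ioo_mem_nhds hx.1 hx.2] with y hy using h (Ioo_subset_Icc_self hy)

theorem ac_congr {v w : ℝ → ℝ} (h : EqOn v w (Icc 0 1))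
    (hv : AbsolutelyContinuousOnInterval v 0 1) : AbsolutelyContinuousOnInterval w 0 1 := by
  rw [absolutelyContinuousOnInterval_iff] at hv ⊢
  intro ε hε
  obtain ⟨δ, hδ, H⟩ := hv ε hε
  refine ⟨δ, hδ, fun E hE hlen => ?_⟩
  refine lt_of_eq_of_lt (Finset.sum_congr rfl fun i hi => ?_) (H E hE hlen)
  have := hE.1 i hi
  rw [uIcc_of_le zero_le_one] at this
  rw [h this.1, h this.2]

/-! ### Change of variables along the primitive of a density. -/

/-- A probability density on the circle. -/
structure IsDensity (q : ℝ → ℝ) : Prop where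
  nonneg : ∀ x, 0 ≤ q x
  integrable : Integrable q lam
  integral_eq_one : ∫ x, q x ∂lam = 1

namespace IsDensity

variable {q : ℝ → ℝ}

theorem prim_one (hq : IsDensity q) : prim q 1 = 1 := by
  rw [prim, ← integral_lam, hq.integral_eq_one]

theorem monotoneOn_prim (hq : IsDensity q) : MonotoneOn (prim q) (Icc 0 1) := by
  intro x hx y hy hxy
  rw [prim, prim, ← setIntegral_lam_Iic _ hx, ← setIntegral_lam_Iic _ hy]
  exact setIntegral_mono_set hq.integrable.integrableOn (ae_of_all _ hq.nonneg)
    (Iic_subset_Iic.2 hxy).eventuallyLE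

theorem mapsTo_prim (hq : IsDensity q) : MapsTo (prim q) (Icc 0 1) (Icc 0 1) := by
  intro x hx
  have h0 := hq.monotoneOn_prim (left_mem_Icc.2 zero_le_one) hx hx.1
  have h1 := hq.monotoneOn_prim hx (right_mem_Icc.2 zero_le_one) hx.2
  rw [prim_zero] at h0
  rw [hq.prim_one] at h1
  exact ⟨h0, h1⟩

theorem prim_mem_MAC (hq : IsDensity q) : prim q ∈ MAC :=
  ⟨hq.mapsTo_prim, hq.monotoneOn_prim, ac_prim hq.integrable, prim_zero q, hq.prim_one⟩

theorem surjOn_prim (hq : IsDensity q) : SurjOn (prim q) (Icc 0 1) (Icc 0 1) := by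
  have := intermediate_value_Icc zero_le_one (continuousOn_prim hq.integrable)
  rwa [prim_zero, hq.prim_one] at this

/-- The measure with density `q`. -/
def measure (q : ℝ → ℝ) : Measure ℝ := lam.withDensity fun x => ENNReal.ofReal (q x)

theorem measure_absolutelyContinuous : measure q ≪ lam := withDensity_absolutelyContinuous _ _

theorem aemeasurable_prim (hq : IsDensity q) : AEMeasurable (prim q) lam :=
  (continuousOn_prim hq.integrable).aemeasurable measurableSet_Icc

theorem ae_measure_iff (hq : IsDensity q) {P : ℝ → Prop} :
    (∀ᵐ x ∂measure q, P x) ↔ ∀ᵐ x ∂lam, q x ≠ 0 → P x := by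
  rw [measure, ae_withDensity_iff' hq.integrable.aemeasurable.ennreal_ofReal]
  refine Filter.eventually_congr (ae_of_all _ fun x => ?_)
  have := hq.nonneg x
  simp only [ne_eq, ENNReal.ofReal_eq_zero, not_le]
  constructor
  · exact fun h h0 => h (lt_of_le_of_ne this (Ne.symm h0))
  · exact fun h h0 => h h0.ne'

theorem measure_Iic (hq : IsDensity q) {x : ℝ} (hx : x ∈ Icc (0 : ℝ) 1) :
    measure q (Iic x) = ENNReal.ofReal (prim q x) := by
  rw [measure, withDensity_apply _ measurableSet_Iic,
    ← ofReal_integral_eq_lintegral_ofReal hq.integrable.integrableOn (ae_of_all _ hq.nonneg),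
    setIntegral_lam_Iic _ hx]
  rfl

theorem isProbabilityMeasure_measure (hq : IsDensity q) : IsProbabilityMeasure (measure q) := by
  constructor
  rw [measure, withDensity_apply _ MeasurableSet.univ, Measure.restrict_univ,
    ← ofReal_integral_eq_lintegral_ofReal hq.integrable (ae_of_all _ hq.nonneg),
    hq.integral_eq_one, ENNReal.ofReal_one]

/-- The primitive of a probability density pushes it forward to Lebesgue measure. -/
theorem map_prim (hq : IsDensity q) : (measure q).map (prim q) = lam := by
  have hm : AEMeasurable (prim q) (measure q) :=
    hq.aemeasurable_prim.mono_ac measure_absolutelyContinuous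
  have hP := hq.isProbabilityMeasure_measure
  have hP' : IsProbabilityMeasure ((measure q).map (prim q)) :=
    Measure.isProbabilityMeasure_map hm
  refine Measure.ext_of_Iic _ _ fun c => ?_
  rw [Measure.map_apply_of_aemeasurable hm measurableSet_Iic]
  have hI : ∀ᵐ x ∂measure q, x ∈ Icc (0 : ℝ) 1 := measure_absolutelyContinuous.ae_le ae_lam_mem_Icc
  rcases lt_or_ge c 0 with hc | hc
  · have h1 : measure q (prim q ⁻¹' Iic c) = 0 := by
      rw [measure_eq_zero_iff_ae_notMem]
      filter_upwards [hI] with x hx hx'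
      exact absurd (hq.mapsTo_prim hx).1 (not_le.2 (lt_of_le_of_lt hx' hc))
    have h2 : lam (Iic c) = 0 := by
      rw [measure_eq_zero_iff_ae_notMem]
      filter_upwards [ae_lam_mem_Icc] with x hx hx'
      exact absurd hx.1 (not_le.2 (lt_of_le_of_lt hx' hc))
    rw [h1, h2]
  rcases lt_or_ge 1 c with hc1 | hc1
  · have h1 : measure q (prim q ⁻¹' Iic c) = 1 := by
      rw [prob_compl_eq_zero_iff₀ (hm.nullMeasurableSet_preimage measurableSet_Iic) |>.symm,
        measure_eq_zero_iff_ae_notMem]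
      filter_upwards [hI] with x hx hx'
      exact hx' ((hq.mapsTo_prim hx).2.trans hc1.le)
    have h2 : lam (Iic c) = 1 := by
      rw [← prob_compl_eq_zero_iff measurableSet_Iic, measure_eq_zero_iff_ae_notMem]
      filter_upwards [ae_lam_mem_Icc] with x hx hx'
      exact hx' (hx.2.trans hc1.le)
    rw [h1, h2]
  have hcomp : IsCompact (Icc (0 : ℝ) 1 ∩ prim q ⁻¹' {c}) :=
    isCompact_Icc.of_isClosed_subset
      ((continuousOn_prim hq.integrable).preimage_isClosed_of_isClosed isClosed_Icc
        isClosed_singleton) inter_subset_left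
  -- The primitive may be constant on intervals; with the last point of the level set, the sublevel
  -- set is exactly an initial segment.
  obtain ⟨x₀, ⟨hx₀, hx₀c⟩, hmax⟩ := hcomp.exists_isGreatest
    (by obtain ⟨x, hx, hxc⟩ := hq.surjOn_prim ⟨hc, hc1⟩; exact ⟨x, hx, hxc⟩)
  have hx₀c : prim q x₀ = c := hx₀c
  have hset : (prim q ⁻¹' Iic c : Set ℝ) =ᵐ[measure q] Iic x₀ := by
    filter_upwards [hI] with x hx
    refine propext ⟨fun h => ?_, fun h => ?_⟩
    · by_contra hlt
      have hlt' : x₀ < x := not_le.1 hlt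
      have h3 := hq.monotoneOn_prim hx₀ hx hlt'.le
      have h4 : prim q x ≤ c := h
      exact absurd (hmax ⟨hx, le_antisymm h4 (hx₀c ▸ h3)⟩) (not_le.2 hlt')
    · have := hq.monotoneOn_prim hx hx₀ h
      exact this.trans_eq hx₀c
  have h1 : lam (Iic c) = ENNReal.ofReal c := by
    rw [← Measure.restrict_apply_univ, lam_restrict_Iic hc1]
    simp
  rw [measure_congr hset, hq.measure_Iic hx₀, hx₀c, h1]

/-- Points with `q x = 0` must be exempted: `prim q` can collapse a set of positive measure, such as
a plateau, into a null set. -/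
theorem ae_comp (hq : IsDensity q) {P : ℝ → Prop} (h : ∀ᵐ y ∂lam, P y) :
    ∀ᵐ x ∂lam, q x ≠ 0 → P (prim q x) := by
  rw [← hq.map_prim] at h
  exact hq.ae_measure_iff.1
    (ae_of_ae_map (hq.aemeasurable_prim.mono_ac measure_absolutelyContinuous) h)

theorem integral_comp (hq : IsDensity q) {k : ℝ → ℝ} (hk : AEStronglyMeasurable k lam) :
    ∫ y, k y ∂lam = ∫ x, q x * k (prim q x) ∂lam := by
  have hm : AEMeasurable (prim q) (measure q) :=
    hq.aemeasurable_prim.mono_ac measure_absolutelyContinuous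
  conv_lhs => rw [← hq.map_prim]
  rw [integral_map hm (by rwa [hq.map_prim]), measure,
    integral_withDensity_eq_integral_toReal_smul₀ hq.integrable.aemeasurable.ennreal_ofReal
      (ae_of_all _ fun _ => ENNReal.ofReal_lt_top)]
  simp [ENNReal.toReal_ofReal (hq.nonneg _)]

theorem integrable_comp_iff (hq : IsDensity q) {k : ℝ → ℝ} (hk : AEStronglyMeasurable k lam) :
    Integrable k lam ↔ Integrable (fun x => q x * k (prim q x)) lam := by
  have hm : AEMeasurable (prim q) (measure q) :=
    hq.aemeasurable_prim.mono_ac measure_absolutelyContinuous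
  conv_lhs => rw [← hq.map_prim]
  rw [integrable_map_measure (by rwa [hq.map_prim]) hm, measure,
    integrable_withDensity_iff_integrable_smul₀' hq.integrable.aemeasurable.ennreal_ofReal
      (ae_of_all _ fun _ => ENNReal.ofReal_lt_top)]
  simp [ENNReal.toReal_ofReal (hq.nonneg _)]

/-- The change of variables `y = φ x` in an integral over an initial segment. -/
theorem prim_comp (hq : IsDensity q) {k : ℝ → ℝ} (hk : AEStronglyMeasurable k lam) {x : ℝ}
    (hx : x ∈ Icc (0 : ℝ) 1) :
    prim k (prim q x) = prim (fun z => q z * k (prim q z)) x := by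
  -- The level set through `x` carries no `q`-mass, so there `z ≤ x` and `prim q z ≤ prim q x` are
  -- interchangeable.
  have h0 : ∀ᵐ y ∂lam, y ≠ prim q x :=
    lam_absolutelyContinuous.ae_le (Measure.ae_ne volume (prim q x))
  rw [prim.eq_1 k, prim.eq_1 (fun z => q z * k (prim q z)),
    ← setIntegral_lam_Iic k (hq.mapsTo_prim hx), ← setIntegral_lam_Iic _ hx, ← integral_indicator measurableSet_Iic, ← integral_indicator measurableSet_Iic,
    hq.integral_comp (hk.indicator measurableSet_Iic)]
  refine integral_congr_ae ?_
  filter_upwards [hq.ae_comp h0, ae_lam_mem_Icc] with z hz hzI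
  by_cases hqz : q z = 0
  · simp [hqz, indicator]
  rcases le_or_gt z x with hzx | hzx
  · rw [indicator_of_mem (show z ∈ Iic x from hzx),
      indicator_of_mem (show prim q z ∈ Iic (prim q x) from hq.monotoneOn_prim hzI hx hzx)]
  · rw [indicator_of_notMem (show z ∉ Iic x from not_le.2 hzx), indicator_of_notMem, mul_zero]
    exact fun h => hz hqz (le_antisymm h (hq.monotoneOn_prim hx hzI hzx.le))

/-- A function vanishing where `q` does factors through the primitive of `q` almost everywhere. -/
theorem exists_comp_prim_eq (hq : IsDensity q) {h : ℝ → ℝ} (hh : AEStronglyMeasurable h lam)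
    (h0 : ∀ᵐ x ∂lam, q x = 0 → h x = 0) :
    ∃ k, AEStronglyMeasurable k lam ∧ ∀ᵐ x ∂lam, k (prim q x) = h x := by
  -- A right inverse `ψ` of the primitive is monotone, hence measurable, and `k` is `h ∘ ψ` off the
  -- countable set `D` of values with several preimages. On `D`, `k` is 0, which is right because
  -- almost every point sent into `D` has `q = 0` and so `h = 0`.
  have hs : ∀ y, ∃ x, y ∈ Icc (0 : ℝ) 1 → x ∈ Icc (0 : ℝ) 1 ∧ prim q x = y := by
    intro y
    by_cases hy : y ∈ Icc (0 : ℝ) 1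
    · obtain ⟨x, hx, hxy⟩ := hq.surjOn_prim hy
      exact ⟨x, fun _ => ⟨hx, hxy⟩⟩
    · exact ⟨0, fun h => absurd h hy⟩
  choose ψ hψ using hs
  have hmono : MonotoneOn ψ (Icc 0 1) := by
    intro y hy y' hy' hyy
    by_contra hlt
    have h1 := hq.monotoneOn_prim (hψ y' hy').1 (hψ y hy).1 (not_le.1 hlt).le
    rw [(hψ y' hy').2, (hψ y hy).2] at h1
    exact hlt (by rw [le_antisymm hyy h1])
  have hψm : AEMeasurable ψ lam := aemeasurable_restrict_of_monotoneOn measurableSet_Icc hmono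
  have hD := hq.monotoneOn_prim.countable_setOfPred_two_preimages
  set D := {c | ∃ x y, x ∈ Icc (0 : ℝ) 1 ∧ y ∈ Icc (0 : ℝ) 1 ∧ x < y ∧ prim q x = c ∧ prim q y = c}
    with hDdef
  refine ⟨Dᶜ.indicator (hh.mk h ∘ ψ), ?_, ?_⟩
  · exact ((hh.stronglyMeasurable_mk.measurable.comp_aemeasurable hψm).indicator
      hD.measurableSet.compl).aestronglyMeasurable
  · have hDn : ∀ᵐ y ∂lam, y ∉ D :=
      lam_absolutelyContinuous.ae_le (measure_eq_zero_iff_ae_notMem.1 (hD.measure_zero volume))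
    filter_upwards [hq.ae_comp hDn, hh.ae_eq_mk, h0, ae_lam_mem_Icc] with x hx hmk h0x hxI
    by_cases hxD : prim q x ∈ D
    · rw [indicator_of_notMem (by simpa using hxD), h0x (by_contra fun hne => hx hne hxD)]
    · rw [indicator_of_mem (show prim q x ∈ Dᶜ from hxD), hmk]
      obtain ⟨h1, h2⟩ := hψ _ (hq.mapsTo_prim hxI)
      have : ψ (prim q x) = x := by
        by_contra hne
        rcases lt_or_gt_of_ne hne with hlt | hlt
        · exact hxD ⟨_, _, h1, hxI, hlt, h2, rfl⟩
        · exact hxD ⟨_, _, hxI, h1, hlt, rfl, h2⟩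
      simp [this]

end IsDensity

/-! ### Tangent vectors in Lagrangian coordinates. -/

/-- `X = (∫₀ˣ η, F)` has finite energy relative to the density `q`, and `η` and `F` vanish where `q`
does. -/
structure IsVelocity (q η : ℝ → ℝ) (X : (ℝ → ℝ) × (ℝ → ℝ)) : Prop where
  integrable : Integrable η lam
  fst_eq : ∀ x ∈ Icc (0 : ℝ) 1, X.1 x = prim η x
  prim_one : prim η 1 = 0
  eq_zero : ∀ᵐ x ∂lam, q x = 0 → η x = 0
  integrable_sq : Integrable (fun x => η x ^ 2 / q x) lam
  aestronglyMeasurable : AEStronglyMeasurable X.2 lam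
  snd_eq_zero : ∀ᵐ x ∂lam, q x = 0 → X.2 x = 0
  integrable_snd_sq : Integrable (fun x => X.2 x ^ 2 * q x) lam

namespace IsVelocity

variable {q η : ℝ → ℝ} {X : (ℝ → ℝ) × (ℝ → ℝ)}

theorem ae_hasDerivAt_fst (hX : IsVelocity q η X) : ∀ᵐ x ∂lam, HasDerivAt X.1 (η x) x := by
  filter_upwards [ae_hasDerivAt_prim hX.integrable, ae_lam_mem_Ioo] with x hx hxI
  exact hx.congr_of_eventuallyEq (eventuallyEq_of_eqOn hX.fst_eq hxI)

theorem ac_fst (hX : IsVelocity q η X) : AbsolutelyContinuousOnInterval X.1 0 1 :=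
  ac_congr (fun x hx => (hX.fst_eq x hx).symm) (ac_prim hX.integrable)

theorem fst_zero (hX : IsVelocity q η X) : X.1 0 = 0 := by
  rw [hX.fst_eq 0 (by simp), prim_zero]

theorem fst_one (hX : IsVelocity q η X) : X.1 1 = 0 := by
  rw [hX.fst_eq 1 (by simp), hX.prim_one]

/-- The chain rule forces `u_x ∘ φ = η/q`. This quotient is 0 where `q` is, by the convention for
division, so it factors through `φ`; the weight `q` turns its square into the integrable `η²/q`. -/
theorem exists_lift (hq : IsDensity q) (hX : IsVelocity q η X) :
    ∃ p, MemLp p 2 lam ∧ (∀ᵐ x ∂lam, p (prim q x) = η x / q x) ∧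
      ∀ x ∈ Icc (0 : ℝ) 1, prim p (prim q x) = prim η x := by
  obtain ⟨p, hpm, hp⟩ := hq.exists_comp_prim_eq (h := fun x => η x / q x)
    (hX.integrable.aestronglyMeasurable.aemeasurable.div
      hq.integrable.aestronglyMeasurable.aemeasurable).aestronglyMeasurable
    (ae_of_all _ fun x hx => by simp [hx])
  refine ⟨p, ?_, hp, fun x hx => ?_⟩
  · refine (memLp_two_iff_integrable_sq hpm).2 ((hq.integrable_comp_iff (hpm.pow 2)).2 ?_)
    refine hX.integrable_sq.congr ?_
    filter_upwards [hp] with x hx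
    by_cases h : q x = 0
    · simp [h]
    · simp only [Pi.pow_apply, hx]
      field_simp
  · rw [hq.prim_comp hpm hx]
    refine prim_congr ?_ hx
    filter_upwards [hp, hX.eq_zero] with z hz hz0
    by_cases h : q z = 0
    · simp [h, hz0 h]
    · simp only [hz]
      field_simp

theorem exists_isTranslate (hq : IsDensity q) (hX : IsVelocity q η X) :
    ∃ w, IsTranslate (prim q) X w := by
  obtain ⟨p, hp2, hp, hpp⟩ := hX.exists_lift hq
  obtain ⟨s, hsm, hs⟩ := hq.exists_comp_prim_eq hX.aestronglyMeasurable hX.snd_eq_zero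
  have hpi : Integrable p lam := hp2.integrable one_le_two
  have hp1 : prim p 1 = 0 := by
    have := hpp 1 (by simp)
    rwa [hq.prim_one, hX.prim_one] at this
  refine ⟨(prim p, s), ⟨⟨⟨⟨ac_prim hpi, (prim_zero p).trans hp1.symm⟩, ?_⟩, prim_zero p⟩, ?_⟩,
    fun x hx => ?_, ?_⟩
  · refine hp2.ae_eq ?_
    filter_upwards [ae_hasDerivAt_prim hpi] with x hx using hx.deriv.symm
  · change MemLp s 2 lam
    refine (memLp_two_iff_integrable_sq hsm).2 ((hq.integrable_comp_iff (hsm.pow 2)).2 ?_)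
    refine hX.integrable_snd_sq.congr ?_
    filter_upwards [hs] with x hx
    simp only [Pi.pow_apply, hx]
    ring
  · exact (hX.fst_eq x hx).trans (hpp x hx).symm
  · filter_upwards [hs] with x hx using hx.symm

theorem isTranslate_pullId (hq : IsDensity q) (hX : IsVelocity q η X) :
    IsTranslate (prim q) X (pullId (prim q) X) := by
  have h := hX.exists_isTranslate hq
  rw [pullId, dif_pos h]
  exact h.choose_spec

variable {w : (ℝ → ℝ) × (ℝ → ℝ)}

/-- Surjectivity of `prim q` determines `w.1` on `[0,1]`, so the formula holds for every translate,
in particular for the one chosen by `pullId`. -/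
theorem deriv_comp (hq : IsDensity q) (hX : IsVelocity q η X) (hw : IsTranslate (prim q) X w) :
    ∀ᵐ x ∂lam, q x ≠ 0 → deriv w.1 (prim q x) = η x / q x := by
  obtain ⟨p, hp2, hp, hpp⟩ := hX.exists_lift hq
  have hEq : EqOn w.1 (prim p) (Icc 0 1) := by
    intro y hy
    obtain ⟨x, hx, rfl⟩ := hq.surjOn_prim hy
    rw [← hw.2.1 x hx, hX.fst_eq x hx, hpp x hx]
  have hd : ∀ᵐ y ∂lam, deriv w.1 y = p y := by
    filter_upwards [ae_hasDerivAt_prim (hp2.integrable one_le_two), ae_lam_mem_Ioo] with y hy hyI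
    exact (hy.congr_of_eventuallyEq (eventuallyEq_of_eqOn hEq hyI)).deriv
  filter_upwards [hq.ae_comp hd, hp] with x hx hpx h
  rw [hx h, hpx]

theorem comp_mul_fst (hq : IsDensity q) (hX : IsVelocity q η X) (hw : IsTranslate (prim q) X w) :
    (fun x => q x * deriv w.1 (prim q x) ^ 2) =ᵐ[lam] fun x => η x ^ 2 / q x := by
  filter_upwards [hX.deriv_comp hq hw] with x hx
  by_cases h : q x = 0
  · simp [h]
  · rw [hx h]
    field_simp

theorem comp_mul_snd (hw : IsTranslate (prim q) X w) :
    (fun x => q x * w.2 (prim q x) ^ 2) =ᵐ[lam] fun x => X.2 x ^ 2 * q x := by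
  filter_upwards [hw.2.2] with x hx
  rw [hx, Function.comp_apply, mul_comm]

theorem memLp_deriv (hw : IsTranslate (prim q) X w) : MemLp (deriv w.1) 2 lam := hw.1.1.1.2

theorem memLp_snd (hw : IsTranslate (prim q) X w) : MemLp w.2 2 lam := hw.1.2

theorem prim_deriv_sq (hq : IsDensity q) (hX : IsVelocity q η X) (hw : IsTranslate (prim q) X w)
    {x : ℝ} (hx : x ∈ Icc (0 : ℝ) 1) :
    prim (fun y => deriv w.1 y * deriv w.1 y) (prim q x) = prim (fun z => η z ^ 2 / q z) x := by
  have h := hq.prim_comp ((memLp_deriv hw).1.pow 2) hx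
  simp only [← pow_two]
  exact h.trans (prim_congr (hX.comp_mul_fst hq hw) hx)

theorem prim_snd_sq (hq : IsDensity q) (hw : IsTranslate (prim q) X w)
    {x : ℝ} (hx : x ∈ Icc (0 : ℝ) 1) :
    prim (fun y => w.2 y * w.2 y) (prim q x) = prim (fun z => X.2 z ^ 2 * q z) x := by
  have h := hq.prim_comp ((memLp_snd hw).1.pow 2) hx
  simp only [← pow_two]
  exact h.trans (prim_congr (comp_mul_snd hw) hx)

theorem innerId_self (hq : IsDensity q) (hX : IsVelocity q η X) (hw : IsTranslate (prim q) X w) :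
    innerId w w = 1 / 4 * ∫ x, (η x ^ 2 / q x + X.2 x ^ 2 * q x) ∂lam := by
  have h1 : (1 : ℝ) ∈ Icc (0 : ℝ) 1 := by simp
  have e1 := hX.prim_deriv_sq hq hw h1
  have e2 := prim_snd_sq hq hw h1
  rw [hq.prim_one] at e1 e2
  rw [innerId, integral_add (by simpa only [pow_two] using (memLp_deriv hw).integrable_sq)
    (by simpa only [pow_two] using (memLp_snd hw).integrable_sq),
    integral_add hX.integrable_sq hX.integrable_snd_sq]
  simp only [integral_lam]
  simp only [prim] at e1 e2
  rw [e1, e2]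

/-- The first component of the Christoffel operator, in Lagrangian coordinates. -/
theorem gammaId_fst_comp (hq : IsDensity q) (hX : IsVelocity q η X)
    (hw : IsTranslate (prim q) X w) {x : ℝ} (hx : x ∈ Icc (0 : ℝ) 1) :
    (GammaId w w).1 (prim q x) =
      1 / 2 * (prim (fun z => η z ^ 2 / q z + X.2 z ^ 2 * q z) x
        - prim q x * prim (fun z => η z ^ 2 / q z + X.2 z ^ 2 * q z) 1) := by
  have h1 : (1 : ℝ) ∈ Icc (0 : ℝ) 1 := by simp
  have hadd : ∀ x ∈ Icc (0 : ℝ) 1, prim (fun z => η z ^ 2 / q z + X.2 z ^ 2 * q z) x =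
      prim (fun z => η z ^ 2 / q z) x + prim (fun z => X.2 z ^ 2 * q z) x := fun x hx =>
    intervalIntegral.integral_add (intervalIntegrable_of_lam hX.integrable_sq hx)
      (intervalIntegrable_of_lam hX.integrable_snd_sq hx)
  have e1 := hX.prim_deriv_sq hq hw h1
  have e2 := prim_snd_sq hq hw h1
  rw [hq.prim_one] at e1 e2
  rw [hadd x hx, hadd 1 h1, ← hX.prim_deriv_sq hq hw hx, ← prim_snd_sq hq hw hx, ← e1, ← e2]
  simp only [GammaId, AinvDx, prim]
  ring

/-- The second component of the Christoffel operator, in Lagrangian coordinates. -/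
theorem gammaId_snd_comp (hq : IsDensity q) (hX : IsVelocity q η X)
    (hw : IsTranslate (prim q) X w) :
    ∀ᵐ x ∂lam, q x ≠ 0 → (GammaId w w).2 (prim q x) = -(η x / q x * X.2 x) := by
  filter_upwards [hX.deriv_comp hq hw, hw.2.2] with x hx hx2 h
  simp only [GammaId, hx h, hx2, Function.comp_apply]
  ring

end IsVelocity

/-! ### The intrinsic tangent conditions and the set `φ_x = 0`. -/

theorem ae_mem_nullSet_iff {q : ℝ → ℝ} {v : ℝ → ℝ} (hv : ∀ᵐ x ∂lam, HasDerivAt v (q x) x) :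
    ∀ᵐ x ∂lam, x ∈ nullSet v ↔ q x = 0 := by
  filter_upwards [hv, ae_lam_mem_Icc] with x hx hxI
  exact ⟨fun h => hx.unique h.2, fun h => ⟨hxI, h ▸ hx⟩⟩

theorem measurableSet_nullSet (v : ℝ → ℝ) : MeasurableSet (nullSet v) := by
  have : nullSet v = Icc 0 1 ∩ ({x | DifferentiableAt ℝ v x} ∩ {x | deriv v x = 0}) := by
    ext x
    refine and_congr_right fun _ => ⟨fun h => ⟨h.differentiableAt, h.deriv⟩, fun h => ?_⟩
    have := h.1.hasDerivAt
    rwa [show deriv v x = 0 from h.2] at this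
  rw [this]
  exact measurableSet_Icc.inter ((measurableSet_of_differentiableAt ℝ v).inter
    (measurableSet_eq_fun (measurable_deriv v) measurable_const))

namespace IsVelocity

variable {q η : ℝ → ℝ} {X : (ℝ → ℝ) × (ℝ → ℝ)}

theorem ae_energyDensity (hq : IsDensity q) (hX : IsVelocity q η X) :
    (fun x => deriv X.1 x ^ 2 / deriv (prim q) x + X.2 x ^ 2 * deriv (prim q) x) =ᵐ[lam]
      fun x => η x ^ 2 / q x + X.2 x ^ 2 * q x := by
  filter_upwards [ae_hasDerivAt_prim hq.integrable, hX.ae_hasDerivAt_fst] with x h1 h2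
  rw [h1.deriv, h2.deriv]

theorem tangentConditions (hq : IsDensity q) (hX : IsVelocity q η X) :
    TangentConditions (prim q) X := by
  refine ⟨⟨hX.ac_fst, by rw [hX.fst_zero, hX.fst_one]⟩, hX.fst_zero, hX.aestronglyMeasurable,
    ?_, ?_⟩
  · rw [ae_restrict_iff' (measurableSet_nullSet _)]
    have : ∀ᵐ x ∂lam, x ∈ nullSet (prim q) → deriv X.1 x = 0 := by
      filter_upwards [ae_mem_nullSet_iff (ae_hasDerivAt_prim hq.integrable), hX.ae_hasDerivAt_fst,
        hX.eq_zero] with x h1 h2 h3 h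
      rw [h2.deriv, h3 (h1.1 h)]
    filter_upwards [(ae_restrict_iff' measurableSet_Icc).1 this] with x hx h using hx h.1 h
  · have : IntegrableOn (fun x => deriv X.1 x ^ 2 / deriv (prim q) x
        + X.2 x ^ 2 * deriv (prim q) x) (Icc 0 1) :=
      (hX.integrable_sq.add hX.integrable_snd_sq).congr (hX.ae_energyDensity hq).symm
    exact this.mono_set sdiff_subset

theorem setIntegral_energyDensity (hq : IsDensity q) (hX : IsVelocity q η X) :
    ∫ x in Icc 0 1 \ nullSet (prim q),
      (deriv X.1 x ^ 2 / deriv (prim q) x + X.2 x ^ 2 * deriv (prim q) x) =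
    ∫ x, (η x ^ 2 / q x + X.2 x ^ 2 * q x) ∂lam := by
  rw [sdiff_eq, inter_comm, ← Measure.restrict_restrict (measurableSet_nullSet _).compl]
  change ∫ x in _, _ ∂lam = _
  rw [← integral_indicator (measurableSet_nullSet _).compl]
  refine integral_congr_ae ?_
  filter_upwards [ae_mem_nullSet_iff (ae_hasDerivAt_prim hq.integrable), hX.ae_energyDensity hq]
    with x h1 h2
  -- Removing the null set costs nothing: where `q = 0` the density reads `η²/0 + F²·0 = 0`.
  by_cases h : q x = 0
  · rw [indicator_of_notMem (by simpa using h1.2 h)]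
    simp [h]
  · rw [indicator_of_mem (show x ∈ (nullSet (prim q))ᶜ from fun hx => h (h1.1 hx)), h2]

end IsVelocity

/-! ### The explicit densities and their time derivatives. -/

/-- The functions `α + β ũ_x + γ (ũ_x² + ρ̃²)`, of which all densities below are instances. -/
def quad (u r : ℝ → ℝ) (α β γ y : ℝ) : ℝ := α + β * deriv u y + γ * (deriv u y ^ 2 + r y ^ 2)

/-- The density `φ_x = f² + g²`. -/
def dens (u r : ℝ → ℝ) (t y : ℝ) : ℝ := f u t y ^ 2 + g r t y ^ 2

/-- The density `φ_{tx}`. -/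
def densDt (u r : ℝ → ℝ) (t : ℝ) : ℝ → ℝ :=
  quad u r (-2 * Real.sin t * Real.cos t) (Real.cos t ^ 2 - Real.sin t ^ 2)
    (Real.sin t * Real.cos t / 2)

/-- The density `f_t² + g_t²`. -/
def speed (u r : ℝ → ℝ) (t y : ℝ) : ℝ :=
  (-Real.sin t + deriv u y / 2 * Real.cos t) ^ 2 + (r y / 2 * Real.cos t) ^ 2

/-- The density `φ_{ttx}`. -/
def densDtt (u r : ℝ → ℝ) (t y : ℝ) : ℝ := 2 * speed u r t y - 2 * dens u r t y

theorem dens_eq_quad (u r : ℝ → ℝ) (t : ℝ) : dens u r t =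
    quad u r (Real.cos t ^ 2) (Real.sin t * Real.cos t) (Real.sin t ^ 2 / 4) := by
  funext y
  simp only [dens, quad, f, g]
  ring

theorem speed_eq_quad (u r : ℝ → ℝ) (t : ℝ) : speed u r t =
    quad u r (Real.sin t ^ 2) (-(Real.sin t * Real.cos t)) (Real.cos t ^ 2 / 4) := by
  funext y
  simp only [speed, quad]
  ring

theorem densDtt_eq_quad (u r : ℝ → ℝ) (t : ℝ) : densDtt u r t =
    quad u r (2 * (Real.sin t ^ 2 - Real.cos t ^ 2)) (-4 * (Real.sin t * Real.cos t))
      ((Real.cos t ^ 2 - Real.sin t ^ 2) / 2) := by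
  funext y
  simp only [densDtt, speed_eq_quad, dens_eq_quad, quad]
  ring

/-- This is `(2 Re(z̄ z_t))² + (2 Im(z̄ z_t))² = 4 |z_t|² |z|²`, the imaginary part being constant
in time. -/
theorem densDt_sq_add (u r : ℝ → ℝ) (t y : ℝ) :
    densDt u r t y ^ 2 + r y ^ 2 = 4 * speed u r t y * dens u r t y := by
  have h := Real.sin_sq_add_cos_sq t
  -- Inserting a power of `sin² + cos² = 1` makes both sides quartic in `sin t` and `cos t`, so that
  -- `ring` applies.
  have h2 : r y ^ 2 = r y ^ 2 * (Real.sin t ^ 2 + Real.cos t ^ 2) ^ 2 := by rw [h]; ring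
  rw [h2]
  simp only [densDt, speed, dens, quad, f, g]
  ring

theorem dens_nonneg (u r : ℝ → ℝ) (t y : ℝ) : 0 ≤ dens u r t y := by
  unfold dens
  positivity

theorem speed_nonneg (u r : ℝ → ℝ) (t y : ℝ) : 0 ≤ speed u r t y := by
  unfold speed
  positivity

theorem densDt_eq_zero {u r : ℝ → ℝ} {t y : ℝ} (h : dens u r t y = 0) : densDt u r t y = 0 := by
  have := densDt_sq_add u r t y
  rw [h, mul_zero] at this
  nlinarith [sq_nonneg (densDt u r t y), sq_nonneg (r y)]

theorem eq_zero_of_dens_eq_zero {u r : ℝ → ℝ} {t y : ℝ} (h : dens u r t y = 0) : r y = 0 := by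
  have := densDt_sq_add u r t y
  rw [h, mul_zero] at this
  nlinarith [sq_nonneg (densDt u r t y), sq_nonneg (r y)]

theorem dens_pos {u r : ℝ → ℝ} {y : ℝ} (h : r y ≠ 0) (t : ℝ) : 0 < dens u r t y :=
  lt_of_le_of_ne (dens_nonneg u r t y) fun h0 => h (eq_zero_of_dens_eq_zero h0.symm)

/-- The coefficients serve both for the values `1, ũ_x, ũ_x² + ρ̃²` at a point and for their
primitives, so `φ` is differentiated in `t` without any interchange of limit and integral. -/
theorem hasDerivAt_quad_dens (A B C t : ℝ) :
    HasDerivAt (fun s => Real.cos s ^ 2 * A + Real.sin s * Real.cos s * B + Real.sin s ^ 2 / 4 * C)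
      (-2 * Real.sin t * Real.cos t * A + (Real.cos t ^ 2 - Real.sin t ^ 2) * B
        + Real.sin t * Real.cos t / 2 * C) t := by
  have hs := Real.hasDerivAt_sin t
  have hc := Real.hasDerivAt_cos t
  convert! (((hc.pow 2).mul_const A).add ((hs.mul hc).mul_const B)).add
    (((hs.pow 2).div_const 4).mul_const C) using 1
  simp
  ring

theorem hasDerivAt_quad_densDt (A B C t : ℝ) :
    HasDerivAt (fun s => -2 * Real.sin s * Real.cos s * A + (Real.cos s ^ 2 - Real.sin s ^ 2) * B
        + Real.sin s * Real.cos s / 2 * C)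
      (2 * (Real.sin t ^ 2 - Real.cos t ^ 2) * A + -4 * (Real.sin t * Real.cos t) * B
        + (Real.cos t ^ 2 - Real.sin t ^ 2) / 2 * C) t := by
  have hs := Real.hasDerivAt_sin t
  have hc := Real.hasDerivAt_cos t
  convert! ((((hs.const_mul (-2)).mul hc).mul_const A).add
    (((hc.pow 2).sub (hs.pow 2)).mul_const B)).add (((hs.mul hc).div_const 2).mul_const C) using 1
  simp
  ring

theorem hasDerivAt_dens (u r : ℝ → ℝ) (t y : ℝ) :
    HasDerivAt (fun s => dens u r s y) (densDt u r t y) t := by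
  have h := hasDerivAt_quad_dens 1 (deriv u y) (deriv u y ^ 2 + r y ^ 2) t
  simp only [dens_eq_quad, densDt, quad]
  simpa only [mul_one] using h

section

variable {u r : ℝ → ℝ}

theorem memLp_deriv_of_mem (hur : (u, r) ∈ tangentId) : MemLp (deriv u) 2 lam := hur.1.1.2

theorem memLp_snd_of_mem (hur : (u, r) ∈ tangentId) : MemLp r 2 lam := hur.2

theorem integrable_sq_add (hur : (u, r) ∈ tangentId) :
    Integrable (fun y => deriv u y ^ 2 + r y ^ 2) lam :=
  (memLp_deriv_of_mem hur).integrable_sq.add (memLp_snd_of_mem hur).integrable_sq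

theorem integrable_quad (hur : (u, r) ∈ tangentId) (α β γ : ℝ) :
    Integrable (quad u r α β γ) lam :=
  ((integrable_const α).add (((memLp_deriv_of_mem hur).integrable one_le_two).const_mul β)).add
    ((integrable_sq_add hur).const_mul γ)

theorem prim_deriv (hur : (u, r) ∈ tangentId) {x : ℝ} (hx : x ∈ Icc (0 : ℝ) 1) :
    prim (deriv u) x = u x := by
  have hac : AbsolutelyContinuousOnInterval u 0 x := hur.1.1.1.1.mono (by
    rw [uIcc_of_le hx.1, uIcc_of_le zero_le_one]; exact Icc_subset_Icc_right hx.2)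
  have h0 : u 0 = 0 := hur.1.2
  rw [prim, hac.integral_deriv_eq_sub, h0, sub_zero]

theorem prim_quad (hur : (u, r) ∈ tangentId) (α β γ : ℝ) {x : ℝ} (hx : x ∈ Icc (0 : ℝ) 1) :
    prim (quad u r α β γ) x = α * x + β * u x
      + γ * prim (fun y => deriv u y ^ 2 + r y ^ 2) x := by
  have i1 := intervalIntegrable_of_lam ((memLp_deriv_of_mem hur).integrable one_le_two) hx
  have i2 := intervalIntegrable_of_lam (integrable_sq_add hur) hx
  have h1 : IntervalIntegrable (fun _ : ℝ => α) volume 0 x := intervalIntegrable_const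
  rw [← prim_deriv hur hx]
  simp only [prim, quad]
  rw [intervalIntegral.integral_add (h1.add (i1.const_mul β)) (i2.const_mul γ),
    intervalIntegral.integral_add h1 (i1.const_mul β), intervalIntegral.integral_const_mul,
    intervalIntegral.integral_const_mul, intervalIntegral.integral_const]
  simp [mul_comm]

/-- Only three fixed functions are differentiated, so a single exceptional null set serves all
coefficients and hence all times. -/
theorem ae_hasDerivAt_prim_quad (hur : (u, r) ∈ tangentId) :
    ∀ᵐ x ∂lam, ∀ α β γ, HasDerivAt (prim (quad u r α β γ)) (quad u r α β γ x) x := by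
  filter_upwards [ae_hasDerivAt_prim ((memLp_deriv_of_mem hur).integrable one_le_two),
    ae_hasDerivAt_prim (integrable_sq_add hur), ae_lam_mem_Ioo] with x h1 h2 hx α β γ
  have h1' := h1.congr_of_eventuallyEq
    (eventuallyEq_of_eqOn (fun y hy => (prim_deriv hur hy).symm) hx)
  have h3 := (((hasDerivAt_id x).const_mul α).add (h1'.const_mul β)).add (h2.const_mul γ)
  rw [mul_one] at h3
  exact h3.congr_of_eventuallyEq
    (eventuallyEq_of_eqOn (fun y hy => prim_quad hur α β γ hy) hx)

theorem prim_quad_one (hur : (u, r) ∈ tangentId)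
    (hnorm : (∫ x, deriv u x ^ 2 ∂lam) + (∫ x, r x ^ 2 ∂lam) = 4) (α β γ : ℝ) :
    prim (quad u r α β γ) 1 = α + 4 * γ := by
  have h1 : u 1 = 0 := hur.1.1.1.2.symm.trans hur.1.2
  rw [prim_quad hur α β γ (by simp), h1, prim, ← integral_lam,
    integral_add (memLp_deriv_of_mem hur).integrable_sq (memLp_snd_of_mem hur).integrable_sq, hnorm]
  ring

theorem isDensity_dens (hur : (u, r) ∈ tangentId)
    (hnorm : (∫ x, deriv u x ^ 2 ∂lam) + (∫ x, r x ^ 2 ∂lam) = 4) (t : ℝ) :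
    IsDensity (dens u r t) := by
  refine ⟨dens_nonneg u r t, ?_, ?_⟩
  · rw [dens_eq_quad]
    exact integrable_quad hur _ _ _
  · rw [integral_lam, dens_eq_quad]
    refine (prim_quad_one hur hnorm _ _ _).trans ?_
    linarith [Real.sin_sq_add_cos_sq t]

theorem integrable_speed (hur : (u, r) ∈ tangentId) (t : ℝ) : Integrable (speed u r t) lam := by
  rw [speed_eq_quad]
  exact integrable_quad hur _ _ _

theorem integral_speed (hur : (u, r) ∈ tangentId)
    (hnorm : (∫ x, deriv u x ^ 2 ∂lam) + (∫ x, r x ^ 2 ∂lam) = 4) (t : ℝ) :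
    ∫ x, speed u r t x ∂lam = 1 := by
  rw [integral_lam, speed_eq_quad]
  refine (prim_quad_one hur hnorm _ _ _).trans ?_
  linarith [Real.sin_sq_add_cos_sq t]

theorem hasDerivAt_phi (hur : (u, r) ∈ tangentId) {x : ℝ} (hx : x ∈ Icc (0 : ℝ) 1) (t : ℝ) :
    HasDerivAt (fun s => phi u r s x) (prim (densDt u r t) x) t := by
  have h : (fun s => phi u r s x) = fun s => Real.cos s ^ 2 * x + Real.sin s * Real.cos s * u x +
      Real.sin s ^ 2 / 4 * prim (fun y => deriv u y ^ 2 + r y ^ 2) x := by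
    funext s
    change prim (dens u r s) x = _
    rw [dens_eq_quad, prim_quad hur _ _ _ hx]
  rw [h, densDt, prim_quad hur _ _ _ hx]
  exact hasDerivAt_quad_dens _ _ _ t

theorem dt_phi (hur : (u, r) ∈ tangentId) {x : ℝ} (hx : x ∈ Icc (0 : ℝ) 1) (t : ℝ) :
    dt (phi u r) t x = prim (densDt u r t) x := (hasDerivAt_phi hur hx t).deriv

theorem hasDerivAt_dt_phi (hur : (u, r) ∈ tangentId) {x : ℝ} (hx : x ∈ Icc (0 : ℝ) 1) (t : ℝ) :
    HasDerivAt (fun s => dt (phi u r) s x) (prim (densDtt u r t) x) t := by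
  simp only [dt_phi hur hx]
  simp only [densDt, densDtt_eq_quad, prim_quad hur _ _ _ hx]
  exact hasDerivAt_quad_densDt _ _ _ t

theorem ae_deriv_phi (hur : (u, r) ∈ tangentId) :
    ∀ᵐ x ∂lam, ∀ t, deriv (phi u r t) x = dens u r t x := by
  filter_upwards [ae_hasDerivAt_prim_quad hur] with x hx t
  have h : phi u r t = prim (dens u r t) := rfl
  rw [h, dens_eq_quad]
  exact (hx _ _ _).deriv

theorem ae_varrho_eq (hur : (u, r) ∈ tangentId) :
    ∀ᵐ x ∂lam, ∀ t, varrho u r t x = r x * ∫ s in (0 : ℝ)..t, 1 / dens u r s x := by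
  filter_upwards [ae_deriv_phi hur] with x hx t
  rw [varrho]
  congr 2
  funext s
  by_cases h : 0 < dens u r s x
  · rw [indicator_of_mem (by simpa [hx] using h), hx]
  -- The indicator is redundant, since `1 / 0 = 0`.
  · have h0 := le_antisymm (not_lt.1 h) (dens_nonneg u r s x)
    rw [indicator_of_notMem (by simpa [hx] using h), h0, div_zero]

theorem continuous_dens (u r : ℝ → ℝ) (x : ℝ) : Continuous fun s => dens u r s x :=
  continuous_iff_continuousAt.2 fun t => (hasDerivAt_dens u r t x).continuousAt

theorem continuous_one_div_dens {x : ℝ} (h : r x ≠ 0) : Continuous fun s => 1 / dens u r s x :=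
  continuous_const.div (continuous_dens u r x) fun s => (dens_pos h s).ne'

/-- If `r x ≠ 0` the density is positive at all times, so the integrand is continuous; otherwise
everything is 0. -/
theorem ae_hasDerivAt_varrho (hur : (u, r) ∈ tangentId) :
    ∀ᵐ x ∂lam, ∀ t, HasDerivAt (fun s => varrho u r s x) (r x / dens u r t x) t := by
  filter_upwards [ae_varrho_eq hur] with x hx t
  simp only [hx]
  by_cases h : r x = 0
  · simpa [h] using hasDerivAt_const t (0 : ℝ)
  · have := ((continuous_one_div_dens (u := u) h).integral_hasStrictDerivAt 0 t).hasDerivAt.const_mul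
      (r x)
    rwa [mul_one_div] at this

theorem ae_dt_varrho (hur : (u, r) ∈ tangentId) :
    ∀ᵐ x ∂lam, ∀ t, dt (varrho u r) t x = r x / dens u r t x := by
  filter_upwards [ae_hasDerivAt_varrho hur] with x hx t using (hx t).deriv

theorem ae_hasDerivAt_dt_varrho (hur : (u, r) ∈ tangentId) :
    ∀ᵐ x ∂lam, ∀ t, HasDerivAt (fun s => dt (varrho u r) s x)
      (-(r x * densDt u r t x / dens u r t x ^ 2)) t := by
  filter_upwards [ae_dt_varrho hur] with x hx t
  simp only [hx]
  by_cases h : r x = 0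
  · simpa [h] using hasDerivAt_const t (0 : ℝ)
  · have := (hasDerivAt_const t (r x)).div (hasDerivAt_dens u r t x) (dens_pos h t).ne'
    convert! this using 1
    ring

end

/-! ### Boundedness of `ϱ`. -/

theorem dens_add_pi (u r : ℝ → ℝ) (x : ℝ) : Function.Periodic (fun s => dens u r s x) Real.pi := by
  intro s
  simp only [dens, f, g, Real.cos_add_pi, Real.sin_add_pi]
  ring

/-- Up to sign the integrand is the angular velocity `Im(z̄ z_t)/|z|²`, and `z` turns by `π` between
1 and -1. The angle is computed as `-arctan(f/|g|)`, with limits `∓π/2` at the ends, where `g`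
vanishes. -/
theorem integral_div_dens_pi {u r : ℝ → ℝ} {x : ℝ} (h : r x ≠ 0) :
    ∫ s in (0 : ℝ)..Real.pi, |r x| / 2 * (1 / dens u r s x) = Real.pi := by
  set c := |r x| / 2 with hc
  have hc0 : 0 < c := by positivity
  have hden : ∀ s, dens u r s x = f u s x ^ 2 + (c * Real.sin s) ^ 2 := by
    intro s
    simp only [dens, g, hc, mul_pow, div_pow, sq_abs]
  have hf : ∀ s, HasDerivAt (fun s => f u s x) (-Real.sin s + deriv u x / 2 * Real.cos s) s :=
    fun s => (Real.hasDerivAt_cos s).add ((Real.hasDerivAt_sin s).const_mul _)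
  have hfc : Continuous fun s => f u s x := by unfold f; fun_prop
  have hsin0 : Filter.Tendsto (fun s => (c * Real.sin s)⁻¹) (nhdsWithin 0 (Ioi 0))
      Filter.atTop := by
    refine Filter.Tendsto.inv_tendsto_nhdsGT_zero (tendsto_nhdsWithin_iff.2 ⟨?_, ?_⟩)
    · have : Continuous fun s => c * Real.sin s := by fun_prop
      simpa using (this.tendsto 0).mono_left nhdsWithin_le_nhds
    · filter_upwards [Ioo_mem_nhdsGT Real.pi_pos] with s hs
      exact mul_pos hc0 (Real.sin_pos_of_mem_Ioo hs)
  have hsinpi : Filter.Tendsto (fun s => (c * Real.sin s)⁻¹) (nhdsWithin Real.pi (Iio Real.pi))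
      Filter.atTop := by
    refine Filter.Tendsto.inv_tendsto_nhdsGT_zero (tendsto_nhdsWithin_iff.2 ⟨?_, ?_⟩)
    · have : Continuous fun s => c * Real.sin s := by fun_prop
      simpa using (this.tendsto Real.pi).mono_left nhdsWithin_le_nhds
    · filter_upwards [Ioo_mem_nhdsLT Real.pi_pos] with s hs
      exact mul_pos hc0 (Real.sin_pos_of_mem_Ioo hs)
  have hf0 : Filter.Tendsto (fun s => f u s x) (nhdsWithin 0 (Ioi 0)) (nhds 1) := by
    simpa [f] using (hfc.tendsto 0).mono_left nhdsWithin_le_nhds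
  have hfpi : Filter.Tendsto (fun s => f u s x) (nhdsWithin Real.pi (Iio Real.pi))
      (nhds (-1)) := by
    simpa [f] using (hfc.tendsto Real.pi).mono_left nhdsWithin_le_nhds
  have hlim0 := (Real.tendsto_arctan_atTop.mono_right nhdsWithin_le_nhds).comp
    (hf0.pos_mul_atTop one_pos hsin0)
  have hlimpi := (Real.tendsto_arctan_atBot.mono_right nhdsWithin_le_nhds).comp
    (hfpi.neg_mul_atTop (by norm_num) hsinpi)
  have hderiv : ∀ s ∈ Ioo 0 Real.pi,
      HasDerivAt (fun s => -Real.arctan (f u s x * (c * Real.sin s)⁻¹))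
        (c * (1 / dens u r s x)) s := by
    intro s hs
    have hsin := Real.sin_pos_of_mem_Ioo hs
    have hg : HasDerivAt (fun s => c * Real.sin s) (c * Real.cos s) s :=
      (Real.hasDerivAt_sin s).const_mul c
    have hg0 : c * Real.sin s ≠ 0 := (mul_pos hc0 hsin).ne'
    have hmain := (((hf s).mul (hg.inv hg0)).arctan).neg
    convert! hmain using 1
    have hq : f u s x ^ 2 + (c * Real.sin s) ^ 2 ≠ 0 := by positivity
    have hone := Real.sin_sq_add_cos_sq s
    have hq2 : 1 + (f u s x * (c * Real.sin s)⁻¹) ^ 2 =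
        (f u s x ^ 2 + (c * Real.sin s) ^ 2) / (c * Real.sin s) ^ 2 := by
      field_simp
      ring
    simp only [Pi.mul_apply, Pi.inv_apply]
    rw [hden, hq2]
    field_simp
    simp only [f]
    linear_combination (-2 : ℝ) * hone
  have hint : IntervalIntegrable (fun s => c * (1 / dens u r s x)) volume 0 Real.pi :=
    (continuous_const.mul (continuous_one_div_dens h)).intervalIntegrable _ _
  rw [intervalIntegral.integral_eq_sub_of_hasDerivAt_of_tendsto Real.pi_pos hderiv hint
    hlim0.neg hlimpi.neg]
  ring

/-- Each half period contributes at most `2π`, whatever `x` is; this uniformity places `ϱ` in `L²`.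
-/
theorem abs_mul_integral_le {u r : ℝ → ℝ} (x t : ℝ) (ht : 0 ≤ t) :
    |r x * ∫ s in (0 : ℝ)..t, 1 / dens u r s x| ≤ 2 * (⌈t / Real.pi⌉₊ * Real.pi) := by
  by_cases h : r x = 0
  · simp only [h, zero_mul, abs_zero]
    positivity
  set n := ⌈t / Real.pi⌉₊
  have hn : t ≤ n * Real.pi := (div_le_iff₀ Real.pi_pos).1 (Nat.le_ceil _)
  have hcont := continuous_one_div_dens (u := u) h
  have hpos : ∀ s, 0 ≤ 1 / dens u r s x := fun s => one_div_nonneg.2 (dens_nonneg u r s x)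
  have h1 : ∫ s in (0 : ℝ)..t, 1 / dens u r s x ≤ ∫ s in (0 : ℝ)..n * Real.pi, 1 / dens u r s x :=
    intervalIntegral.integral_mono_interval le_rfl ht hn (ae_of_all _ hpos)
      (hcont.intervalIntegrable _ _)
  have hper : Function.Periodic (fun s => 1 / dens u r s x) Real.pi := fun s => by
    simp only [dens_add_pi u r x s]
  have h2 : ∫ s in (0 : ℝ)..n * Real.pi, 1 / dens u r s x =
      n * ∫ s in (0 : ℝ)..Real.pi, 1 / dens u r s x := by
    have := hper.intervalIntegral_add_zsmul_eq n 0
      (fun a b => hcont.intervalIntegrable a b)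
    simpa using this
  have h3 := integral_div_dens_pi (u := u) h
  rw [intervalIntegral.integral_const_mul] at h3
  rw [abs_mul, abs_of_nonneg (intervalIntegral.integral_nonneg ht fun s _ => hpos s)]
  calc |r x| * ∫ s in (0 : ℝ)..t, 1 / dens u r s x
      ≤ |r x| * (n * ∫ s in (0 : ℝ)..Real.pi, 1 / dens u r s x) :=
        mul_le_mul_of_nonneg_left (h1.trans_eq h2) (abs_nonneg _)
    _ = 2 * (n * Real.pi) := by linear_combination (2 * (n : ℝ)) * h3

theorem memLp_varrho {u r : ℝ → ℝ} (hur : (u, r) ∈ tangentId) {t : ℝ} (ht : 0 ≤ t) :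
    varrho u r t ∈ H0 := by
  have hr := (memLp_snd_of_mem hur).1
  -- A measurable representative makes the integrand jointly measurable in `(x, s)`, as the
  -- parameter integral requires.
  set r' := hr.mk r
  have hr' : Measurable r' := hr.stronglyMeasurable_mk.measurable
  have hm : StronglyMeasurable fun x => r' x * ∫ s in Ioc 0 t, 1 / dens u r' s x := by
    refine hr'.stronglyMeasurable.mul (StronglyMeasurable.integral_prod_right ?_)
    refine Measurable.stronglyMeasurable ?_
    have hu := measurable_deriv u
    simp only [Function.uncurry_def, dens, f, g]
    fun_prop
  have hae : varrho u r t =ᵐ[lam] fun x => r' x * ∫ s in Ioc 0 t, 1 / dens u r' s x := by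
    filter_upwards [ae_varrho_eq hur, hr.ae_eq_mk] with x hx hrx
    rw [hx, intervalIntegral.integral_of_le ht]
    simp only [dens, g, hrx, r']
  refine MemLp.of_bound (hm.aestronglyMeasurable.congr hae.symm)
    (2 * (⌈t / Real.pi⌉₊ * Real.pi)) ?_
  filter_upwards [ae_varrho_eq hur] with x hx
  rw [hx, Real.norm_eq_abs]
  exact abs_mul_integral_le x t ht

/-! ### Energy of the velocity. -/

/-- At zeros of the density the left side is 0 while `speed` need not be; this is the source of the
energy loss. -/
theorem div_dens_sum {u r : ℝ → ℝ} (t x : ℝ) (F : ℝ) (hF : F = r x / dens u r t x) :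
    densDt u r t x ^ 2 / dens u r t x + F ^ 2 * dens u r t x =
      {y | dens u r t y ≠ 0}.indicator (fun y => 4 * speed u r t y) x := by
  by_cases h : dens u r t x = 0
  · simp [h]
  · rw [indicator_of_mem (show x ∈ {y | dens u r t y ≠ 0} from h), hF]
    have := densDt_sq_add u r t x
    field_simp
    linear_combination this

theorem ae_vel_snd {u r : ℝ → ℝ} (hur : (u, r) ∈ tangentId) (t : ℝ) :
    ∀ᵐ x ∂lam, (vel u r t).2 x = r x / dens u r t x := by
  filter_upwards [ae_dt_varrho hur] with x hx using hx t

theorem nullMeasurableSet_dens_eq_zero {u r : ℝ → ℝ} (hur : (u, r) ∈ tangentId) (t : ℝ) :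
    NullMeasurableSet {y | dens u r t y = 0} lam := by
  rw [dens_eq_quad]
  exact (integrable_quad hur _ _ _).aestronglyMeasurable.aemeasurable.nullMeasurableSet_preimage
    (measurableSet_singleton 0)

theorem isVelocity_vel {u r : ℝ → ℝ} (hur : (u, r) ∈ tangentId)
    (hnorm : (∫ x, deriv u x ^ 2 ∂lam) + (∫ x, r x ^ 2 ∂lam) = 4) (t : ℝ) :
    IsVelocity (dens u r t) (densDt u r t) (vel u r t) := by
  have hdm : AEMeasurable (dens u r t) lam :=
    (isDensity_dens hur hnorm t).integrable.aestronglyMeasurable.aemeasurable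
  have hηi : Integrable (densDt u r t) lam := integrable_quad hur _ _ _
  have hηm := hηi.aestronglyMeasurable.aemeasurable
  have hrm : AEMeasurable r lam := (memLp_snd_of_mem hur).1.aemeasurable
  have hF : (vel u r t).2 =ᵐ[lam] fun x => r x / dens u r t x := ae_vel_snd hur t
  have hFm : AEStronglyMeasurable (vel u r t).2 lam :=
    (hrm.div hdm).aestronglyMeasurable.congr hF.symm
  -- Both summands are nonnegative, so this one bound makes each of them integrable.
  have hsum : ∀ᵐ x ∂lam, densDt u r t x ^ 2 / dens u r t x
      + (vel u r t).2 x ^ 2 * dens u r t x ≤ 4 * speed u r t x := by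
    filter_upwards [hF] with x hx
    rw [div_dens_sum t x _ hx]
    exact indicator_le_self' (fun y _ => mul_nonneg zero_le_four (speed_nonneg u r t y)) x
  have h1 : ∀ x, 0 ≤ densDt u r t x ^ 2 / dens u r t x := fun x =>
    div_nonneg (sq_nonneg _) (dens_nonneg u r t x)
  have h2 : ∀ x, 0 ≤ (vel u r t).2 x ^ 2 * dens u r t x := fun x =>
    mul_nonneg (sq_nonneg _) (dens_nonneg u r t x)
  have hsp := (integrable_speed hur t).const_mul 4
  refine ⟨hηi, fun x hx => dt_phi hur hx t, ?_, ae_of_all _ fun x hx => densDt_eq_zero hx, ?_,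
    hFm, ?_, ?_⟩
  · rw [densDt, prim_quad_one hur hnorm]
    ring
  · refine hsp.mono' ((hηm.pow_const 2).div hdm).aestronglyMeasurable ?_
    filter_upwards [hsum] with x hx
    rw [Real.norm_of_nonneg (h1 x)]
    linarith [h2 x]
  · filter_upwards [hF] with x hx h
    rw [hx, h, div_zero]
  · refine hsp.mono' ((hFm.aemeasurable.pow_const 2).mul hdm).aestronglyMeasurable ?_
    filter_upwards [hsum] with x hx
    rw [Real.norm_of_nonneg (h2 x)]
    linarith [h1 x]

theorem integral_energyDensity {u r : ℝ → ℝ} (hur : (u, r) ∈ tangentId)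
    (hnorm : (∫ x, deriv u x ^ 2 ∂lam) + (∫ x, r x ^ 2 ∂lam) = 4) (t : ℝ) :
    1 / 4 * ∫ x, (densDt u r t x ^ 2 / dens u r t x
      + (vel u r t).2 x ^ 2 * dens u r t x) ∂lam =
      1 - ∫ x in {y | dens u r t y = 0}, speed u r t x ∂lam := by
  have hns := nullMeasurableSet_dens_eq_zero hur t
  have hsp := integrable_speed hur t
  have h1 := integral_sub hsp (hsp.indicator₀ hns)
  rw [integral_speed hur hnorm t, integral_indicator₀ hns] at h1
  rw [← h1, ← integral_const_mul]
  refine integral_congr_ae ?_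
  filter_upwards [ae_vel_snd hur t] with x hx
  rw [div_dens_sum t x _ hx]
  by_cases h : dens u r t x = 0
  · simp [h]
  · simp [h]

/-- On the zero set `ũ_x = -2 cot t` and `ρ̃ = 0`, so `speed` is `(sin² t + cos² t)²/sin² t`, a
constant. When `sin t = 0` the density is 1 and the set is empty. -/
theorem energyValue_eq {u r : ℝ → ℝ} (hur : (u, r) ∈ tangentId) (t : ℝ) :
    energyValue u r t = 1 - ∫ x in {y | dens u r t y = 0}, speed u r t x ∂lam := by
  have hone := Real.sin_sq_add_cos_sq t
  by_cases hs : Real.sin t = 0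
  · have : {y | dens u r t y = 0} = ∅ := by
      ext y
      have hc : Real.cos t ^ 2 = 1 := by rw [← hone, hs]; ring
      simp [dens, f, g, hs, hc]
    rw [energyValue, if_pos hs, this]
    simp
  have hset : {x | deriv u x = -2 * Real.cot t} ∩ {x | r x = 0} = {y | dens u r t y = 0} := by
    ext y
    have h1 : dens u r t y = 0 ↔ f u t y = 0 ∧ g r t y = 0 := by
      rw [dens, add_eq_zero_iff_of_nonneg (sq_nonneg _) (sq_nonneg _), sq_eq_zero_iff,
        sq_eq_zero_iff]
    have h2 : g r t y = 0 ↔ r y = 0 := by simp [g, hs]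
    have h3 : f u t y = 0 ↔ deriv u y = -2 * Real.cot t := by
      rw [f, Real.cot_eq_cos_div_sin]
      constructor
      · intro h
        field_simp
        linear_combination 2 * h
      · intro h
        rw [h]
        field_simp
        ring
    simp only [mem_inter_iff, mem_ofPred_eq, h1, h2, h3]
  have hconst : ∫ x in {y | dens u r t y = 0}, speed u r t x ∂lam =
      ∫ x in {y | dens u r t y = 0}, 1 / Real.sin t ^ 2 ∂lam := by
    refine integral_congr_ae ((ae_restrict_iff'₀ (nullMeasurableSet_dens_eq_zero hur t)).2 ?_)
    refine ae_of_all _ fun x hx => ?_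
    rw [← hset] at hx
    have h1 : deriv u x = -2 * Real.cot t := hx.1
    have h2 : r x = 0 := hx.2
    rw [speed, h1, h2, Real.cot_eq_cos_div_sin]
    field_simp
    linear_combination 4 * (Real.sin t ^ 2 + Real.cos t ^ 2 + 1) * hone
  rw [energyValue, if_neg hs, hset, hconst, setIntegral_const, smul_eq_mul, mul_comm]

/-! ### Generic times and the geodesic equation. -/

/-- Two zeros `t`, `t₀` satisfy `sin (t - t₀) = 0`, so they differ by a multiple of `π`. -/
theorem countable_zeros (c : ℝ) : {t : ℝ | Real.cos t + c * Real.sin t = 0}.Countable := by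
  by_cases h : ∃ t₀, Real.cos t₀ + c * Real.sin t₀ = 0
  · obtain ⟨t₀, h₀⟩ := h
    refine (countable_range fun n : ℤ => t₀ + n * Real.pi).mono fun t ht => ?_
    have ht : Real.cos t + c * Real.sin t = 0 := ht
    have hz : Real.sin (t - t₀) = 0 := by
      rw [Real.sin_sub]
      linear_combination Real.sin t * h₀ - Real.sin t₀ * ht
    obtain ⟨n, hn⟩ := Real.sin_eq_zero_iff.1 hz
    exact ⟨n, by simp only [hn]; ring⟩
  · have : {t : ℝ | Real.cos t + c * Real.sin t = 0} = ∅ :=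
      eq_empty_iff_forall_notMem.2 fun t ht => h ⟨t, ht⟩
    rw [this]
    exact countable_empty

theorem ae_ae_dens_ne_zero (u r : ℝ → ℝ) : ∀ᵐ t : ℝ, ∀ᵐ x ∂lam, dens u r t x ≠ 0 := by
  have hu := measurable_deriv u
  have hm : MeasurableSet {p : ℝ × ℝ | Real.cos p.1 + deriv u p.2 / 2 * Real.sin p.1 ≠ 0} :=
    (measurableSet_eq_fun (by fun_prop) (by fun_prop)).compl
  -- Nonvanishing of `f` alone suffices, and it involves only `deriv u`, which is Borel measurable;
  -- `r` need not be.
  have h : ∀ᵐ t : ℝ, ∀ᵐ x ∂lam, Real.cos t + deriv u x / 2 * Real.sin t ≠ 0 := by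
    rw [Measure.ae_ae_comm (p := fun t x => Real.cos t + deriv u x / 2 * Real.sin t ≠ 0) hm]
    exact ae_of_all _ fun x =>
      measure_eq_zero_iff_ae_notMem.1 ((countable_zeros (deriv u x / 2)).measure_zero volume)
  filter_upwards [h] with t ht
  filter_upwards [ht] with x hx h0
  have hpos : 0 < f u t x ^ 2 := by
    rw [f]
    positivity
  rw [dens] at h0
  linarith [sq_nonneg (g r t x)]

theorem energyValue_eq_one {u r : ℝ → ℝ} (hur : (u, r) ∈ tangentId) {t : ℝ}
    (h : ∀ᵐ x ∂lam, dens u r t x ≠ 0) :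
    energyValue u r t = 1 := by
  have h0 : lam {y | dens u r t y = 0} = 0 := measure_eq_zero_iff_ae_notMem.2 h
  rw [energyValue_eq hur, setIntegral_measure_zero _ h0, sub_zero]

theorem energy_eq {u r : ℝ → ℝ} (hur : (u, r) ∈ tangentId)
    (hnorm : (∫ x, deriv u x ^ 2 ∂lam) + (∫ x, r x ^ 2 ∂lam) = 4) (t : ℝ) :
    energy u r t = energyValue u r t := by
  have hq := isDensity_dens hur hnorm t
  have hX := isVelocity_vel hur hnorm t
  rw [energyValue_eq hur, ← integral_energyDensity hur hnorm t]
  exact hX.innerId_self hq (hX.isTranslate_pullId hq)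

/-- With no zeros the energy density is `4 |z_t|²`, of total mass 4, so `Γ` gives `2 ∫₀ˣ |z_t|² -
2φ`. This is `φ_tt`, because `z_tt = -z` yields `φ_ttx = 2|z_t|² - 2|z|²`. -/
theorem geodesic_fst {u r : ℝ → ℝ} (hur : (u, r) ∈ tangentId)
    (hnorm : (∫ x, deriv u x ^ 2 ∂lam) + (∫ x, r x ^ 2 ∂lam) = 4) {t : ℝ}
    (ht : ∀ᵐ x ∂lam, dens u r t x ≠ 0) {x : ℝ} (hx : x ∈ Icc (0 : ℝ) 1) :
    dt (dt (phi u r)) t x = (GammaAt (phi u r t) (vel u r t) (vel u r t)).1 x := by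
  have hq := isDensity_dens hur hnorm t
  have hX := isVelocity_vel hur hnorm t
  have h1 : (1 : ℝ) ∈ Icc (0 : ℝ) 1 := by simp
  have hsp := integrable_speed hur t
  have key : ∀ x ∈ Icc (0 : ℝ) 1, prim (fun z => densDt u r t z ^ 2 / dens u r t z
      + (vel u r t).2 z ^ 2 * dens u r t z) x = 4 * prim (speed u r t) x := by
    intro x hx
    rw [prim.eq_1 (speed u r t), ← intervalIntegral.integral_const_mul]
    refine prim_congr ?_ hx
    filter_upwards [ht, ae_vel_snd hur t] with z hz hv
    rw [div_dens_sum t z _ hv, indicator_of_mem hz]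
  have hs1 : prim (speed u r t) 1 = 1 := by
    rw [prim, ← integral_lam, integral_speed hur hnorm]
  have hΓ := hX.gammaId_fst_comp hq (hX.isTranslate_pullId hq) hx
  rw [key x hx, key 1 h1, hs1] at hΓ
  refine ((hasDerivAt_dt_phi hur hx t).deriv.trans ?_).trans hΓ.symm
  simp only [densDtt, prim]
  rw [intervalIntegral.integral_sub ((intervalIntegrable_of_lam hsp hx).const_mul 2)
    ((intervalIntegrable_of_lam hq.integrable hx).const_mul 2),
    intervalIntegral.integral_const_mul, intervalIntegral.integral_const_mul]
  ring

theorem geodesic_snd {u r : ℝ → ℝ} (hur : (u, r) ∈ tangentId)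
    (hnorm : (∫ x, deriv u x ^ 2 ∂lam) + (∫ x, r x ^ 2 ∂lam) = 4) {t : ℝ}
    (ht : ∀ᵐ x ∂lam, dens u r t x ≠ 0) :
    ∀ᵐ x ∂lam, dt (dt (varrho u r)) t x =
      (GammaAt (phi u r t) (vel u r t) (vel u r t)).2 x := by
  have hq := isDensity_dens hur hnorm t
  have hX := isVelocity_vel hur hnorm t
  filter_upwards [ht, ae_hasDerivAt_dt_varrho hur, ae_vel_snd hur t,
    hX.gammaId_snd_comp hq (hX.isTranslate_pullId hq)] with x hx h1 h2 h3
  refine ((h1 t).deriv.trans ?_).trans (h3 hx).symm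
  rw [h2]
  field_simp

end HS

end

theorem mainTheorem2 (u r : ℝ → ℝ) (hur : (u, r) ∈ HS.tangentId)
    (hnorm : (∫ x, deriv u x ^ 2 ∂HS.lam) + (∫ x, r x ^ 2 ∂HS.lam) = 4) :
    -- the time derivatives exist
    (∀ x ∈ Set.Icc (0 : ℝ) 1, ∀ t : ℝ, 0 ≤ t →
      DifferentiableAt ℝ (fun s => HS.phi u r s x) t ∧
      DifferentiableAt ℝ (fun s => HS.dt (HS.phi u r) s x) t) ∧
    (∀ᵐ x ∂HS.lam, ∀ t : ℝ, 0 ≤ t →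
      DifferentiableAt ℝ (fun s => HS.varrho u r s x) t ∧
      DifferentiableAt ℝ (fun s => HS.dt (HS.varrho u r) s x) t) ∧
    -- (i)
    (∀ t : ℝ, 0 ≤ t → (HS.phi u r t, HS.varrho u r t) ∈ HS.MAC0) ∧
    -- (ii)
    (∀ t : ℝ, 0 ≤ t →
      HS.vel u r t ∈ HS.tangent (HS.phi u r t) ∧
      HS.TangentConditions (HS.phi u r t) (HS.vel u r t)) ∧
    -- (iii)
    (∀ t : ℝ, 0 ≤ t →
      HS.energy u r t = HS.energyValue u r t ∧
      1 / 4 * (∫ x in Set.Icc 0 1 \ HS.nullSet (HS.phi u r t),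
        ((deriv (HS.vel u r t).1 x) ^ 2 / deriv (HS.phi u r t) x
          + (HS.vel u r t).2 x ^ 2 * deriv (HS.phi u r t) x)) = HS.energyValue u r t) ∧
    (∀ᵐ t ∂MeasureTheory.volume.restrict (Set.Ici (0 : ℝ)),
      HS.energy u r t = HS.energy u r 0) ∧
    -- (iv)
    (∀ᵐ t ∂MeasureTheory.volume.restrict (Set.Ici (0 : ℝ)),
      (∀ x ∈ Set.Icc (0 : ℝ) 1, HS.dt (HS.dt (HS.phi u r)) t x =
        (HS.GammaAt (HS.phi u r t) (HS.vel u r t) (HS.vel u r t)).1 x) ∧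
      (∀ᵐ x ∂HS.lam, HS.dt (HS.dt (HS.varrho u r)) t x =
        (HS.GammaAt (HS.phi u r t) (HS.vel u r t) (HS.vel u r t)).2 x)) := by
  
  have hgood := ae_restrict_of_ae (s := Ici (0 : ℝ)) (HS.ae_ae_dens_ne_zero u r)
  refine ⟨fun x hx t _ => ?_, ?_, fun t ht => ?_, fun t _ => ?_, fun t _ => ?_, ?_, ?_⟩
  · exact ⟨(HS.hasDerivAt_phi hur hx t).differentiableAt,
      (HS.hasDerivAt_dt_phi hur hx t).differentiableAt⟩
  · filter_upwards [HS.ae_hasDerivAt_varrho hur, HS.ae_hasDerivAt_dt_varrho hur] with x h1 h2 t _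
    exact ⟨(h1 t).differentiableAt, (h2 t).differentiableAt⟩
  · exact ⟨(HS.isDensity_dens hur hnorm t).prim_mem_MAC, HS.memLp_varrho hur ht⟩
  · have hq := HS.isDensity_dens hur hnorm t
    have hX := HS.isVelocity_vel hur hnorm t
    exact ⟨hX.exists_isTranslate hq, hX.tangentConditions hq⟩
  · have hq := HS.isDensity_dens hur hnorm t
    have hX := HS.isVelocity_vel hur hnorm t
    refine ⟨HS.energy_eq hur hnorm t, ?_⟩
    rw [HS.energyValue_eq hur, ← HS.integral_energyDensity hur hnorm t]
    exact congrArg (1 / 4 * ·) (hX.setIntegral_energyDensity hq)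
  · filter_upwards [hgood] with t ht
    rw [HS.energy_eq hur hnorm, HS.energy_eq hur hnorm, HS.energyValue_eq_one hur ht]
    simp [HS.energyValue]
  · filter_upwards [hgood] with t ht
    exact ⟨fun x hx => HS.geodesic_fst hur hnorm ht hx, HS.geodesic_snd hur hnorm ht⟩
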